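/- Let $\beta_0,n,\delta,\gamma,r>0$ be real, let $k=2e^{-\gamma r}$, and consider the delay differential equation $$\dot x(t)=-\Big[\frac{\beta_0}{1+x(t)^n}+\delta\Big]x(t)+k\,\frac{\beta_0\,x(t-r)}{1+x(t-r)^n},\qquad t\ge 0,$$ with initial condition $x|_{[-r,0]}=\phi$, where $\phi\in C([-r,0],\mathbb R)$ and $\phi\ge 0$; let $|\phi|_0$ be the supremum norm. Put $A=\beta_0(k-1)/\delta$. The zero solution $x_1=0$ is called stable if for every $\varepsilon>0$ there is $\eta>0$ such that $\phi\ge0$ and $|\phi|_0<\eta$ imply $0\le x(t,\phi)<\varepsilon$ for all $t>0$, and unstable otherwise; it is called locally asymptotically stable if it is stable and there is $\eta>0$ such that $\phi\ge0$ and $|\phi|_0<\eta$ imply $x(t,\phi)\to0$ as $t\to\infty$. Eigenvalues are those of the infinitesimal generator of the semigroup on $C([-r,0],\mathbb C)$ of the equation linearized at $0$, $\dot z(t)=-(\beta_0+\delta)z(t)+k\beta_0z(t-r)$; that is, the complex numbers $\lambda$ for which there is a nonzero $C^1$ function $\varphi:[-r,0]\to\mathbb C$ with $\varphi'=\lambda\varphi$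 and $\varphi'(0)=-(\beta_0+\delta)\varphi(0)+k\beta_0\varphi(-r)$. Then: 1. For every $\phi\ge0$ the Cauchy problem has exactly one solution $x(\cdot,\phi)$ on $[-r,\infty)$, and it is nonnegative. 2. If $A\le1$, then $x_1=0$ is the only nonnegative equilibrium; if $A>1$, then the nonnegative equilibria are exactly $x_1=0$ and $x_2=(A-1)^{1/n}>0$. 3. The eigenvalues are exactly the solutions $\lambda\in\mathbb C$ of $\lambda+\delta+\beta_0=k\beta_0e^{-\lambda r}$, and all of them have strictly negative real part if and only if $A<1$. 4. $x_1$ is locally asymptotically stable if and only if $A\le1$, i.e. if and only if it is the only nonnegative equilibrium. If $A>1$, i.e. once $x_2$ exists, $x_1$ is unstable. 5. The change of stability occurs by an eigenvalue passing through $\lambda=0$: there is a continuous real-valued function $\mu$ of the parameters $(\beta_0,n,\delta,\gamma,r)\in(0,\infty)^5$ such that, for all parameters, $\mu$ is an eigenvalue, every other eigenvalue has real part strictly less than $\mu$, and $\mu<0$, $\mu=0$, $\mu>0$ if and only if $A<1$, $A=1$, $A>1$, respectively. -/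

import Mathlib

noncomputable section

namespace Leukemia

/-- The positive parameters of the delay equation. -/
structure Params where
  β₀ : ℝ
  n : ℝ
  δ : ℝ
  γ : ℝ
  r : ℝ
  β₀_pos : 0 < β₀
  n_pos : 0 < n
  δ_pos : 0 < δ
  γ_pos : 0 < γ
  r_pos : 0 < r

namespace Params

/-- The topology of the parameter set as a subset of `ℝ⁵`. -/
instance : TopologicalSpace Params :=
  TopologicalSpace.induced (fun P => (P.β₀, P.n, P.δ, P.γ, P.r)) inferInstance

variable (P : Params)

/-- `k = 2 e^{-γ r}`. -/
def k : ℝ := 2 * Real.exp (-(P.γ * P.r))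

/-- The quantity `β₀ (k - 1) / δ`. -/
def ratio : ℝ := P.β₀ * (P.k - 1) / P.δ

/-- `β(x) = β₀ / (1 + x ^ n)`. -/
def β (x : ℝ) : ℝ := P.β₀ / (1 + x ^ P.n)

/-- The right-hand side of the delay equation, with `u = x(t)` and `v = x(t - r)`. -/
def rhs (u v : ℝ) : ℝ := -(P.β u + P.δ) * u + P.k * (P.β v * v)

/-- The end points of `[-r, 0]`. -/
def left : Set.Icc (-P.r) 0 := ⟨-P.r, le_refl _, neg_nonpos.mpr P.r_pos.le⟩

def right : Set.Icc (-P.r) 0 := ⟨0, neg_nonpos.mpr P.r_pos.le, le_refl _⟩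

/-- `x : [-r, ∞) → ℝ` is the solution of the Cauchy problem with initial function `φ`
(values of `x` to the left of `-r` are irrelevant). At `t = 0` the derivative is one-sided,
at `t > 0` it is the usual derivative. -/
structure IsSolution (φ : C(Set.Icc (-P.r) 0, ℝ)) (x : ℝ → ℝ) : Prop where
  continuousOn : ContinuousOn x (Set.Ici (-P.r))
  initial : ∀ s : Set.Icc (-P.r) 0, x s = φ s
  hasDeriv : ∀ t : ℝ, 0 ≤ t →
    HasDerivWithinAt x (P.rhs (x t) (x (t - P.r))) (Set.Ici 0) t

/-- A nonnegative equilibrium: a number `c ≥ 0` such that the constant function `c` solves the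
equation. -/
def IsEquilibrium (c : ℝ) : Prop :=
  0 ≤ c ∧ P.IsSolution (ContinuousMap.const _ c) (fun _ => c)

/-- Stability of the zero solution, for nonnegative initial functions; `‖φ‖` is the supremum
norm. -/
def ZeroStable : Prop :=
  ∀ ε : ℝ, 0 < ε → ∃ η : ℝ, 0 < η ∧
    ∀ (φ : C(Set.Icc (-P.r) 0, ℝ)) (x : ℝ → ℝ), (∀ s, 0 ≤ φ s) → ‖φ‖ < η →
      P.IsSolution φ x → ∀ t : ℝ, 0 < t → 0 ≤ x t ∧ x t < ε

/-- Local asymptotic stability of the zero solution: stability and local attractivity. -/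
def ZeroLocallyAsymptoticallyStable : Prop :=
  P.ZeroStable ∧ ∃ η : ℝ, 0 < η ∧
    ∀ (φ : C(Set.Icc (-P.r) 0, ℝ)) (x : ℝ → ℝ), (∀ s, 0 ≤ φ s) → ‖φ‖ < η →
      P.IsSolution φ x → Filter.Tendsto x Filter.atTop (nhds 0)

/-- The coefficient `B` of the linearization at `c`, i.e. the derivative of `x ↦ β(x) x` on
`[0, ∞)` at `c`. -/
def linCoeff (c : ℝ) : ℝ := derivWithin (fun x => P.β x * x) (Set.Ici 0) c

/-- The graph of the infinitesimal generator of the (complexified) solution semigroup on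
`C([-r, 0])` of the linearized equation `z'(t) = -(B + δ) z(t) + k B z(t - r)` at `c`:
`φ` is continuously differentiable with `φ' = ψ`, and `φ'(0) = -(B + δ) φ(0) + k B φ(-r)`. -/
def GeneratorGraph (c : ℝ) (φ ψ : C(Set.Icc (-P.r) 0, ℂ)) : Prop :=
  (∀ s : Set.Icc (-P.r) 0,
    HasDerivWithinAt (Set.IccExtend (neg_nonpos.mpr P.r_pos.le) φ) (ψ s)
      (Set.Icc (-P.r) 0) (s : ℝ)) ∧
  ψ P.right = -((P.linCoeff c + P.δ : ℝ) : ℂ) * φ P.right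
    + ((P.k * P.linCoeff c : ℝ) : ℂ) * φ P.left

/-- `z` is an eigenvalue of the generator of the linearization at `c`. -/
def IsEigenvalueAt (c : ℝ) (z : ℂ) : Prop :=
  ∃ φ : C(Set.Icc (-P.r) 0, ℂ), φ ≠ 0 ∧ P.GeneratorGraph c φ (z • φ)

end Params

end Leukemia

end

/-!
*Well-posedness.* The nonlinearity `u ↦ β(u) u` is Lipschitz on `[0, ∞)`. Cut off on the negative
half-line, it yields a globally Lipschitz delay equation, solved on `[0, ∞)` by the contraction
principle in an exponentially weighted space of bounded functions (`exists_delay_solution`). The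
right-hand side is positive for slightly negative present and nonnegative delayed values, so
solutions with nonnegative past stay nonnegative (`delay_solution_nonneg`); this applies to the
cut-off and to the original equation alike, and uniqueness then follows on intervals of length `r`
from uniqueness for ordinary differential equations with Lipschitz right-hand side.

*Eigenvalues.* An eigenfunction is a multiple of `s ↦ e^{z s}`, which gives the characteristic
equation. Its real form `charFun` is strictly increasing; its only real zero `leading` has the sign
of `ratio - 1` because `charFun 0 = δ (1 - ratio)`, and it dominates the other eigenvalues by the
triangle inequality (`re_lt_leading`). It depends continuously on the parameters because
`leading P < a` and `a < leading P` are open conditions on `charFun P a`.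

*Stability.* Along a nonnegative solution `V(t) = x(t) + k ∫_{t-r}^t β(x) x` has derivative
`((k - 1) β(x) - δ) x`. For `ratio ≤ 1` this is negative for `x > 0`, so `x ≤ V` gives stability,
also in the critical case `ratio = 1`. As `V` then converges and solutions decay at most
exponentially, `x` tends to `0` (`IsSolution.tendsto_zero`). For `1 < ratio` the derivative is
positive for small `x > 0`; a solution staying small would by the same lemma tend to `0`, and so
would `V`, although `V` increases from a positive value.
-/

/-! ### The nonlinearity -/

namespace Leukemia.Params
open Set Filter Topology

variable (P : Params)

theorem k_pos : 0 < P.k := by unfold k; positivity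

theorem β_pos {u : ℝ} (hu : 0 ≤ u) : 0 < P.β u := by
  have := P.β₀_pos
  have := Real.rpow_nonneg hu P.n
  unfold β; positivity

theorem β_le {u : ℝ} (hu : 0 ≤ u) : P.β u ≤ P.β₀ := by
  have := Real.rpow_nonneg hu P.n
  exact div_le_self P.β₀_pos.le (by linarith)

theorem β_zero : P.β 0 = P.β₀ := by
  simp [β, Real.zero_rpow P.n_pos.ne']

theorem β_anti {u v : ℝ} (hu : 0 ≤ u) (huv : u ≤ v) : P.β v ≤ P.β u := by
  have h1 := Real.rpow_nonneg hu P.n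
  have h2 := Real.rpow_le_rpow hu huv P.n_pos.le
  exact div_le_div_of_nonneg_left P.β₀_pos.le (by linarith) (by linarith)

theorem β_lt {u : ℝ} (hu : 0 < u) : P.β u < P.β₀ := by
  have := Real.rpow_pos_of_pos hu P.n
  exact div_lt_self P.β₀_pos (by linarith)

/-- `β` is continuous at `0` from both sides: `|x ^ n| ≤ |x| ^ n` also for negative `x`. -/
theorem continuousAt_β_zero : ContinuousAt P.β 0 := by
  have h : ContinuousAt (fun x : ℝ => x ^ P.n) 0 := Real.continuousAt_rpow_const _ _ (Or.inr P.n_pos.le)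
  unfold β
  exact continuousAt_const.div (continuousAt_const.add h) (by simp [Real.zero_rpow P.n_pos.ne'])

theorem hasDerivWithinAt_β_mul_zero :
    HasDerivWithinAt (fun x => P.β x * x) P.β₀ (Ici 0) 0 := by
  refine HasDerivAt.hasDerivWithinAt ?_
  rw [hasDerivAt_iff_tendsto_slope]
  have h := P.continuousAt_β_zero.tendsto
  rw [β_zero] at h
  refine (h.mono_left nhdsWithin_le_nhds).congr' ?_
  filter_upwards [self_mem_nhdsWithin] with x hx
  have hx : x ≠ 0 := hx
  simp [slope_def_field, hx]

theorem linCoeff_zero : P.linCoeff 0 = P.β₀ :=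
  P.hasDerivWithinAt_β_mul_zero.derivWithin (uniqueDiffOn_Ici 0 0 self_mem_Ici)

theorem hasDerivAt_β_mul {u : ℝ} (hu : 0 < u) :
    HasDerivAt (fun x => P.β x * x)
      (P.β₀ * (1 + (1 - P.n) * u ^ P.n) / (1 + u ^ P.n) ^ 2) u := by
  have hp := Real.rpow_pos_of_pos hu P.n
  have h1 : HasDerivAt (fun x : ℝ => 1 + x ^ P.n) (P.n * u ^ (P.n - 1)) u :=
    (Real.hasDerivAt_rpow_const (Or.inl hu.ne')).const_add 1
  have h2 := ((hasDerivAt_const u P.β₀).div h1 (by positivity)).mul (hasDerivAt_id u)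
  refine h2.congr_deriv ?_
  have h3 : u ^ (P.n - 1) = u ^ P.n / u := by rw [Real.rpow_sub_one hu.ne']
  simp only [h3, id]
  field_simp
  simp only [Pi.div_apply]
  field_simp
  ring

/-- The nonlinearity `x ↦ β(x) x`, extended by `0` to the negative half-line. -/
noncomputable def flux (u : ℝ) : ℝ := P.β (max u 0) * max u 0

theorem flux_of_nonneg {u : ℝ} (hu : 0 ≤ u) : P.flux u = P.β u * u := by
  simp [flux, max_eq_left hu]

theorem flux_nonneg (u : ℝ) : 0 ≤ P.flux u :=
  mul_nonneg (P.β_pos (le_max_right u 0)).le (le_max_right u 0)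

theorem flux_le {u : ℝ} (hu : 0 ≤ u) : P.flux u ≤ P.β₀ * u := by
  rw [P.flux_of_nonneg hu]
  exact mul_le_mul_of_nonneg_right (P.β_le hu) hu

theorem flux_zero : P.flux 0 = 0 := by simp [flux]

/-- A Lipschitz constant of `x ↦ β(x) x` on `[0, ∞)`. -/
noncomputable def fluxLip : NNReal :=
  ⟨P.β₀ * (1 + P.n), mul_nonneg P.β₀_pos.le (add_nonneg zero_le_one P.n_pos.le)⟩

theorem lipschitzOnWith_β_mul : LipschitzOnWith P.fluxLip (fun x => P.β x * x) (Ici 0) := by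
  have hb := P.β₀_pos
  have hn := P.n_pos
  have key : ∀ u ∈ Ici (0 : ℝ), ∃ d : ℝ,
      HasDerivWithinAt (fun x => P.β x * x) d (Ici 0) u ∧ ‖d‖₊ ≤ P.fluxLip := by
    intro u hu
    rcases (mem_Ici.1 hu).eq_or_lt with rfl | hu
    · refine ⟨_, P.hasDerivWithinAt_β_mul_zero, ?_⟩
      rw [← NNReal.coe_le_coe, coe_nnnorm, Real.norm_eq_abs, abs_of_pos hb]
      change P.β₀ ≤ P.β₀ * (1 + P.n)
      nlinarith
    · refine ⟨_, (P.hasDerivAt_β_mul hu).hasDerivWithinAt, ?_⟩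
      have hp := Real.rpow_pos_of_pos hu P.n
      rw [← NNReal.coe_le_coe, coe_nnnorm, Real.norm_eq_abs]
      change |_| ≤ P.β₀ * (1 + P.n)
      rw [mul_div_assoc, abs_mul, abs_of_pos hb]
      refine mul_le_mul_of_nonneg_left ?_ hb.le
      rw [abs_div, abs_of_pos (by positivity : 0 < (1 + u ^ P.n) ^ 2), div_le_iff₀ (by positivity),
        abs_le]
      constructor <;> nlinarith [mul_pos hn hp, mul_pos hp hp, mul_pos hn (mul_pos hp hp)]
  choose! d hd hd' using key
  exact (convex_Ici 0).lipschitzOnWith_of_nnnorm_hasDerivWithin_le hd hd'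

theorem abs_flux_sub_le (u v : ℝ) : |P.flux u - P.flux v| ≤ P.fluxLip * |u - v| := by
  have h := P.lipschitzOnWith_β_mul.dist_le_mul (max u 0) (le_max_right u 0) (max v 0)
    (le_max_right v 0)
  refine h.trans (mul_le_mul_of_nonneg_left ?_ P.fluxLip.coe_nonneg)
  exact abs_max_sub_max_le_abs u v 0

theorem continuous_flux : Continuous P.flux :=
  (LipschitzWith.of_dist_le_mul (K := P.fluxLip) P.abs_flux_sub_le).continuous

end Leukemia.Params

/-! ### Delay equations with Lipschitz right-hand side -/

namespace Leukemia
open Set Filter Topology MeasureTheory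

theorem abs_exp_neg_mul_integral_le {l K t : ℝ} {g : ℝ → ℝ} (hl : 0 < l) (hK : 0 ≤ K) (ht : 0 ≤ t)
    (hg : ∀ s, 0 ≤ s → |g s| ≤ K * Real.exp (l * s)) :
    |Real.exp (-(l * t)) * ∫ s in (0 : ℝ)..t, g s| ≤ K / l := by
  have h1 : |∫ s in (0 : ℝ)..t, g s| ≤ ∫ s in (0 : ℝ)..t, K * Real.exp (l * s) := by
    rw [← Real.norm_eq_abs]
    refine intervalIntegral.norm_integral_le_of_norm_le ht ?_ ?_
    · exact Eventually.of_forall fun s hs => hg s hs.1.le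
    · exact (by fun_prop : Continuous fun s => K * Real.exp (l * s)).intervalIntegrable _ _
  have h2 : ∫ s in (0 : ℝ)..t, K * Real.exp (l * s) = K / l * (Real.exp (l * t) - 1) := by
    rw [intervalIntegral.integral_eq_sub_of_hasDerivAt (f := fun s => K / l * Real.exp (l * s))]
    · simp; ring
    · intro s _
      have := (((hasDerivAt_id s).const_mul l).exp).const_mul (K / l)
      refine this.congr_deriv ?_
      simp; field_simp
    · exact (by fun_prop : Continuous fun s => K * Real.exp (l * s)).intervalIntegrable _ _
  rw [abs_mul, abs_of_pos (Real.exp_pos _)]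
  have h3 : Real.exp (-(l * t)) * Real.exp (l * t) = 1 := by rw [← Real.exp_add]; simp
  have h4 := Real.exp_pos (-(l * t))
  calc _ ≤ Real.exp (-(l * t)) * (K / l * (Real.exp (l * t) - 1)) :=
        mul_le_mul_of_nonneg_left (h1.trans h2.le) h4.le
    _ = K / l * (1 - Real.exp (-(l * t))) := by linear_combination (K / l) * h3
    _ ≤ K / l * 1 := by gcongr; linarith
    _ = K / l := mul_one _

/-- Global existence for an autonomous equation `x'(t) = G (x(t)) (x(t - r))` with globally
Lipschitz `G`, by the contraction principle on all of `[0, ∞)` at once: writing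
`x(t) = φ(min t 0) + e^{l t⁺} w(t⁺)`, the integral equation becomes a fixed point equation for the
bounded continuous function `w`, and it is a contraction once `l` exceeds the Lipschitz constant. -/
theorem exists_delay_solution {G : ℝ → ℝ → ℝ} {L r C : ℝ} (hL : 0 ≤ L) (hr : 0 ≤ r)
    (h0 : G 0 0 = 0) (hG : ∀ u v u' v', |G u v - G u' v'| ≤ L * (|u - u'| + |v - v'|))
    {φ : ℝ → ℝ} (hφ : Continuous φ) (hC : ∀ s, |φ s| ≤ C) :
    ∃ x : ℝ → ℝ, Continuous x ∧ (∀ s ≤ 0, x s = φ s) ∧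
      ∀ t, 0 ≤ t → HasDerivWithinAt x (G (x t) (x (t - r))) (Ici 0) t := by
  have hC0 : 0 ≤ C := (abs_nonneg _).trans (hC 0)
  have hGc : Continuous (fun p : ℝ × ℝ => G p.1 p.2) := by
    refine (LipschitzWith.of_dist_le_mul (K := ⟨L * 2, by positivity⟩) fun p q => ?_).continuous
    refine (hG _ _ _ _).trans ?_
    change _ ≤ L * 2 * dist p q
    rw [mul_assoc]
    refine mul_le_mul_of_nonneg_left ?_ hL
    rw [two_mul, Prod.dist_eq]
    exact add_le_add (le_max_left (dist p.1 q.1) _) (le_max_right _ (dist p.2 q.2))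
  -- with this weight the contraction constant `2 L / l` is at most `1 / 2`
  obtain ⟨l, hl, hlL⟩ : ∃ l : ℝ, 0 < l ∧ 2 * L / l ≤ 1 / 2 :=
    ⟨4 * L + 1, by positivity, by rw [div_le_div_iff₀ (by positivity) two_pos]; linarith⟩
  let X : BoundedContinuousFunction ℝ ℝ → ℝ → ℝ := fun w s =>
    φ (min s 0) + Real.exp (l * max s 0) * w (max s 0)
  have hX : ∀ w, Continuous (X w) := fun w => by
    have := w.continuous
    fun_prop
  let g : BoundedContinuousFunction ℝ ℝ → ℝ → ℝ := fun w s => G (X w s) (X w (s - r))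
  have hg : ∀ w, Continuous (g w) := fun w =>
    hGc.comp ((hX w).prodMk ((hX w).comp (by fun_prop : Continuous fun s : ℝ => s - r)))
  have hmax : ∀ s a : ℝ, 0 ≤ s → a ≤ s → Real.exp (l * max a 0) ≤ Real.exp (l * s) := by
    intro s a hs ha
    have : max a 0 ≤ s := max_le ha hs
    gcongr
  have hXb : ∀ w s a, 0 ≤ s → a ≤ s → |X w a| ≤ (C + ‖w‖) * Real.exp (l * s) := by
    intro w s a hs ha
    have h1 : 1 ≤ Real.exp (l * s) := Real.one_le_exp (by positivity)
    calc |X w a| ≤ |φ (min a 0)| + |Real.exp (l * max a 0) * w (max a 0)| := abs_add_le _ _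
      _ ≤ C + Real.exp (l * s) * ‖w‖ := by
        rw [abs_mul, abs_of_pos (Real.exp_pos _)]
        exact add_le_add (hC _) (mul_le_mul (hmax s a hs ha) (w.norm_coe_le_norm _) (abs_nonneg _)
          (Real.exp_pos _).le)
      _ ≤ (C + ‖w‖) * Real.exp (l * s) := by nlinarith
  have hXd : ∀ w w' s a, 0 ≤ s → a ≤ s → |X w a - X w' a| ≤ dist w w' * Real.exp (l * s) := by
    intro w w' s a hs ha
    have : X w a - X w' a = Real.exp (l * max a 0) * (w (max a 0) - w' (max a 0)) := by
      simp only [X]; ring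
    rw [this, abs_mul, abs_of_pos (Real.exp_pos _), mul_comm]
    exact mul_le_mul (w.dist_coe_le_dist _) (hmax s a hs ha) (Real.exp_pos _).le dist_nonneg
  have hgb : ∀ w s, 0 ≤ s → |g w s| ≤ L * (2 * (C + ‖w‖)) * Real.exp (l * s) := by
    intro w s hs
    have h1 := hG (X w s) (X w (s - r)) 0 0
    rw [h0, sub_zero, sub_zero, sub_zero] at h1
    have h2 := hXb w s s hs le_rfl
    have h3 := hXb w s (s - r) hs (by linarith)
    refine h1.trans ?_
    rw [mul_assoc]
    refine mul_le_mul_of_nonneg_left ?_ hL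
    linarith
  have hgd : ∀ w w' s, 0 ≤ s → |g w s - g w' s| ≤ L * (2 * dist w w') * Real.exp (l * s) := by
    intro w w' s hs
    have h2 := hXd w w' s s hs le_rfl
    have h3 := hXd w w' s (s - r) hs (by linarith)
    refine (hG _ _ _ _).trans ?_
    rw [mul_assoc]
    refine mul_le_mul_of_nonneg_left ?_ hL
    linarith
  have hI : ∀ w, Continuous fun t => ∫ s in (0 : ℝ)..t, g w s := fun w =>
    intervalIntegral.continuous_primitive (fun a b => (hg w).intervalIntegrable a b) 0
  let T : BoundedContinuousFunction ℝ ℝ → BoundedContinuousFunction ℝ ℝ := fun w =>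
    BoundedContinuousFunction.ofNormedAddCommGroup
      (fun t => Real.exp (-(l * max t 0)) * ∫ s in (0 : ℝ)..(max t 0), g w s)
      ((by fun_prop : Continuous fun t : ℝ => Real.exp (-(l * max t 0))).mul
        ((hI w).comp (by fun_prop : Continuous fun t : ℝ => max t 0)))
      (L * (2 * (C + ‖w‖)) / l)
      (fun t => abs_exp_neg_mul_integral_le hl (by positivity) (le_max_right _ _) (hgb w))
  have hTc : ContractingWith (1 / 2) T := by
    refine ⟨by norm_num, LipschitzWith.of_dist_le_mul fun w w' => ?_⟩
    refine (BoundedContinuousFunction.dist_le (by positivity)).2 fun t => ?_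
    have h1 : T w t - T w' t = Real.exp (-(l * max t 0)) *
        ∫ s in (0 : ℝ)..(max t 0), (g w s - g w' s) := by
      rw [intervalIntegral.integral_sub ((hg w).intervalIntegrable _ _)
        ((hg w').intervalIntegrable _ _), mul_sub]
      rfl
    rw [Real.dist_eq, h1]
    refine (abs_exp_neg_mul_integral_le hl (by positivity) (le_max_right _ _) (hgd w w')).trans ?_
    have : L * (2 * dist w w') / l = 2 * L / l * dist w w' := by ring
    rw [this]
    refine (mul_le_mul_of_nonneg_right hlL dist_nonneg).trans_eq ?_
    simp
  obtain ⟨w, hw⟩ : ∃ w, T w = w := ⟨_, hTc.fixedPoint_isFixedPt⟩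
  have hw' : ∀ t, 0 ≤ t → w t = Real.exp (-(l * t)) * ∫ s in (0 : ℝ)..t, g w s := by
    intro t ht
    have h1 := DFunLike.congr_fun hw t
    have h2 : T w t = Real.exp (-(l * max t 0)) * ∫ s in (0 : ℝ)..(max t 0), g w s := rfl
    rw [← h1, h2, max_eq_left ht]
  have hxt : ∀ t, 0 ≤ t → X w t = φ 0 + ∫ s in (0 : ℝ)..t, g w s := by
    intro t ht
    have h3 : Real.exp (l * t) * Real.exp (-(l * t)) = 1 := by rw [← Real.exp_add]; simp
    simp only [X, min_eq_right ht, max_eq_left ht]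
    rw [hw' t ht, ← mul_assoc, h3, one_mul]
  refine ⟨X w, hX w, fun s hs => ?_, fun t ht => ?_⟩
  · simp only [X, min_eq_left hs, max_eq_right hs]
    rw [hw' 0 le_rfl]
    simp
  · have h1 : HasDerivAt (fun t => φ 0 + ∫ s in (0 : ℝ)..t, g w s) (g w t) t :=
      (intervalIntegral.integral_hasDerivAt_right ((hg w).intervalIntegrable _ _)
        ((hg w).stronglyMeasurableAtFilter _ _) (hg w).continuousAt).const_add _
    exact h1.hasDerivWithinAt.congr (fun s hs => hxt s hs) (hxt t ht)

/-- Induction on intervals of the length of the delay. -/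
theorem forall_of_delay_step {r : ℝ} (hr : 0 < r) {p : ℝ → Prop}
    (h0 : ∀ t, -r ≤ t → t ≤ 0 → p t)
    (step : ∀ a, 0 ≤ a → (∀ t, -r ≤ t → t ≤ a → p t) → ∀ t, a ≤ t → t ≤ a + r → p t) :
    ∀ t, -r ≤ t → p t := by
  have key : ∀ N : ℕ, ∀ t, -r ≤ t → t ≤ N * r → p t := by
    intro N
    induction N with
    | zero => simpa using h0
    | succ N ih =>
      intro t ht1 ht2
      rcases le_total t (N * r) with h | h
      · exact ih t ht1 h
      · exact step _ (by positivity) ih t h (by push_cast at ht2; linarith)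
  intro t ht
  obtain ⟨N, hN⟩ := exists_nat_ge (t / r)
  exact key N t ht ((div_le_iff₀ hr).1 hN)

/-- A solution with nonnegative past stays nonnegative if the right-hand side is positive for
slightly negative present and nonnegative delayed values. -/
theorem delay_solution_nonneg {G : ℝ → ℝ → ℝ} {r ε : ℝ} (hr : 0 < r) (hε : 0 < ε)
    (hG : ∀ u v, -ε < u → u < 0 → 0 ≤ v → 0 < G u v) {x : ℝ → ℝ}
    (hx : ContinuousOn x (Ici (-r))) (hinit : ∀ t, -r ≤ t → t ≤ 0 → 0 ≤ x t)
    (hd : ∀ t, 0 ≤ t → HasDerivWithinAt x (G (x t) (x (t - r))) (Ici 0) t) :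
    ∀ t, -r ≤ t → 0 ≤ x t := by
  refine forall_of_delay_step hr hinit fun a ha hpast t hat htr => ?_
  refine le_of_forall_pos_le_add fun e he => ?_
  have hm : 0 < min e (ε / 2) := lt_min he (by positivity)
  have hme : min e (ε / 2) < ε := (min_le_right _ _).trans_lt (by linarith)
  -- `x` cannot cross a level `-η` with `0 < η < ε` downwards
  have := image_le_of_deriv_right_lt_deriv_boundary' (f := fun t => -x t)
    (f' := fun t => -G (x t) (x (t - r))) (a := a) (b := a + r) (B := fun _ => min e (ε / 2))
    (B' := fun _ => 0)
    (hx.neg.mono fun s hs => mem_Ici.2 (by linarith [hs.1]))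
    (fun s hs => ((hd s (ha.trans hs.1)).mono (Ici_subset_Ici.2 (ha.trans hs.1))).neg)
    (by linarith [hpast a (by linarith) le_rfl]) continuousOn_const
    (fun s _ => hasDerivWithinAt_const _ _ _)
    (fun s hs heq => by
      have heq : -x s = min e (ε / 2) := heq
      have hv := hpast (s - r) (by linarith [hs.1]) (by linarith [hs.2])
      linarith [hG (x s) (x (s - r)) (by linarith) (by linarith) hv])
    ⟨hat, htr⟩
  have this : -x t ≤ min e (ε / 2) := this
  linarith [min_le_left e (ε / 2)]

end Leukemia

/-! ### Well-posedness of the Cauchy problem -/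

namespace Leukemia.Params
open Set Filter Topology

variable (P : Params)

theorem rhs_of_nonneg {u v : ℝ} (hu : 0 ≤ u) (hv : 0 ≤ v) :
    P.rhs u v = -P.flux u - P.δ * u + P.k * P.flux v := by
  rw [P.flux_of_nonneg hu, P.flux_of_nonneg hv, rhs]
  ring

theorem rhs_self {c : ℝ} : P.rhs c c = c * ((P.k - 1) * P.β c - P.δ) := by
  unfold rhs; ring

/-- For `n` with `(-1) ^ n < 0` the function `β` may be negative or singular on the negative
half-line, but not close to `0`. -/
theorem exists_rhs_pos : ∃ ε > 0, ∀ u v, -ε < u → u < 0 → 0 ≤ v → 0 < P.rhs u v := by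
  have h := P.continuousAt_β_zero.eventually (lt_mem_nhds (a := 0) (by rw [β_zero]; exact P.β₀_pos))
  obtain ⟨ε, hε, hb⟩ := Metric.eventually_nhds_iff.1 h
  refine ⟨ε, hε, fun u v h1 h2 h3 => ?_⟩
  have hbu : 0 < P.β u := hb (by rw [Real.dist_eq, sub_zero, abs_of_neg h2]; linarith)
  have h4 : 0 ≤ P.k * (P.β v * v) := mul_nonneg P.k_pos.le (mul_nonneg (P.β_pos h3).le h3)
  have h5 := mul_neg_of_pos_of_neg (add_pos hbu P.δ_pos) h2
  unfold rhs
  linarith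

variable {P} {φ : C(Icc (-P.r) 0, ℝ)} {x y : ℝ → ℝ}

theorem IsSolution.nonneg (h : P.IsSolution φ x) (hφ : ∀ s, 0 ≤ φ s) : ∀ t, -P.r ≤ t → 0 ≤ x t := by
  obtain ⟨ε, hε, hp⟩ := P.exists_rhs_pos
  exact delay_solution_nonneg P.r_pos hε hp h.continuousOn
    (fun t h1 h2 => (hφ ⟨t, h1, h2⟩).trans_eq (h.initial ⟨t, h1, h2⟩).symm) h.hasDeriv

theorem IsSolution.congr (h : P.IsSolution φ x) (hxy : EqOn y x (Ici (-P.r))) :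
    P.IsSolution φ y where
  continuousOn := h.continuousOn.congr hxy
  initial s := (hxy s.2.1).trans (h.initial s)
  hasDeriv t ht := by
    have hr := P.r_pos
    rw [hxy (mem_Ici.2 (by linarith) : t ∈ Ici (-P.r)),
      hxy (mem_Ici.2 (by linarith) : t - P.r ∈ Ici (-P.r))]
    exact (h.hasDeriv t ht).congr (fun s hs => hxy (mem_Ici.2 (by linarith [mem_Ici.1 hs])))
      (hxy (mem_Ici.2 (by linarith)))

theorem IsSolution.eqOn (hx : P.IsSolution φ x) (hy : P.IsSolution φ y) (hφ : ∀ s, 0 ≤ φ s) :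
    EqOn y x (Ici (-P.r)) := by
  have hr := P.r_pos
  refine forall_of_delay_step (p := fun t => y t = x t) P.r_pos
    (fun t h1 h2 => (hy.initial ⟨t, h1, h2⟩).trans (hx.initial ⟨t, h1, h2⟩).symm)
    fun a ha hpast t hat htr => ?_
  have hv : ∀ s ∈ Ico a (a + P.r), LipschitzOnWith (P.fluxLip + P.δ.toNNReal)
      (fun u => P.rhs u (x (s - P.r))) (Ici 0) := by
    intro s hs
    refine LipschitzOnWith.of_dist_le_mul fun u hu v hv => ?_
    have hw := hx.nonneg hφ (s - P.r) (by linarith [hs.1])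
    rw [P.rhs_of_nonneg hu hw, P.rhs_of_nonneg hv hw, Real.dist_eq, Real.dist_eq]
    have h1 : (-P.flux u - P.δ * u + P.k * P.flux (x (s - P.r))) -
        (-P.flux v - P.δ * v + P.k * P.flux (x (s - P.r))) =
        -(P.flux u - P.flux v) - P.δ * (u - v) := by ring
    rw [h1, NNReal.coe_add, Real.coe_toNNReal _ P.δ_pos.le, add_mul]
    refine (abs_sub _ _).trans (add_le_add ?_ ?_)
    · rw [abs_neg]
      exact P.abs_flux_sub_le u v
    · rw [abs_mul, abs_of_pos P.δ_pos]
  refine ODE_solution_unique_of_mem_Icc_right hv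
    (hy.continuousOn.mono fun s hs => mem_Ici.2 (by linarith [hs.1])) (fun s hs => ?_)
    (fun s hs => hy.nonneg hφ s (by linarith [hs.1]))
    (hx.continuousOn.mono fun s hs => mem_Ici.2 (by linarith [hs.1])) (fun s hs => ?_)
    (fun s hs => hx.nonneg hφ s (by linarith [hs.1]))
    (hpast a (by linarith) le_rfl) ⟨hat, htr⟩
  · have := (hy.hasDeriv s (ha.trans hs.1)).mono (Ici_subset_Ici.2 (ha.trans hs.1))
    rwa [hpast (s - P.r) (by linarith [hs.1]) (by linarith [hs.2])] at this
  · exact (hx.hasDeriv s (ha.trans hs.1)).mono (Ici_subset_Ici.2 (ha.trans hs.1))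

variable (P)

/-- The equation with the nonlinearity cut off on the negative half-line has a global solution,
which is nonnegative and therefore solves the original equation. -/
theorem exists_isSolution (φ : C(Icc (-P.r) 0, ℝ)) (hφ : ∀ s, 0 ≤ φ s) :
    ∃ x, P.IsSolution φ x := by
  have hr := P.r_pos
  have hk := P.k_pos
  have hδ := P.δ_pos
  have hF := P.fluxLip.coe_nonneg
  have hG : ∀ u v u' v', |(-P.flux u - P.δ * u + P.k * P.flux v) -
      (-P.flux u' - P.δ * u' + P.k * P.flux v')| ≤
      (P.fluxLip + P.δ + P.k * P.fluxLip) * (|u - u'| + |v - v'|) := by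
    intro u v u' v'
    have h1 := P.abs_flux_sub_le u u'
    have h2 : |P.k * (P.flux v - P.flux v')| ≤ P.k * (P.fluxLip * |v - v'|) := by
      rw [abs_mul, abs_of_pos hk]
      exact mul_le_mul_of_nonneg_left (P.abs_flux_sub_le v v') hk.le
    have h3 : |P.δ * (u - u')| = P.δ * |u - u'| := by rw [abs_mul, abs_of_pos hδ]
    have h4 : (-P.flux u - P.δ * u + P.k * P.flux v) -
      (-P.flux u' - P.δ * u' + P.k * P.flux v') =
      -(P.flux u - P.flux u') - P.δ * (u - u') + P.k * (P.flux v - P.flux v') := by ring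
    rw [h4]
    have h5 := abs_add_le (-(P.flux u - P.flux u') - P.δ * (u - u')) (P.k * (P.flux v - P.flux v'))
    have h6 := abs_sub (-(P.flux u - P.flux u')) (P.δ * (u - u'))
    rw [abs_neg] at h6
    have h7 : 0 ≤ P.k * P.fluxLip * |u - u'| := by positivity
    have h8 : 0 ≤ (P.fluxLip + P.δ) * |v - v'| := by positivity
    linarith
  have hle : -P.r ≤ 0 := neg_nonpos.2 hr.le
  obtain ⟨x, hxc, hx0, hxd⟩ := exists_delay_solution (C := ‖φ‖)
    (G := fun u v => -P.flux u - P.δ * u + P.k * P.flux v) (by positivity) hr.le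
    (by simp [flux_zero]) hG (φ := IccExtend hle φ) (φ.continuous.Icc_extend' )
    (fun s => φ.norm_coe_le_norm _)
  have hinit : ∀ s : Icc (-P.r) 0, x s = φ s := fun s => by
    rw [hx0 s s.2.2, IccExtend_val]
  have hnn := delay_solution_nonneg hr one_pos
    (G := fun u v => -P.flux u - P.δ * u + P.k * P.flux v)
    (fun u v _ hu hv => by
      have h1 : P.flux u = 0 := by simp [flux, max_eq_right hu.le]
      have h2 := mul_nonneg hk.le (P.flux_nonneg v)
      have h3 := mul_neg_of_pos_of_neg hδ hu
      simp only [h1]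
      linarith)
    hxc.continuousOn (fun t h1 h2 => (hφ ⟨t, h1, h2⟩).trans_eq (hinit ⟨t, h1, h2⟩).symm) hxd
  refine ⟨x, hxc.continuousOn, hinit, fun t ht => ?_⟩
  rw [P.rhs_of_nonneg (hnn t (by linarith)) (hnn _ (by linarith))]
  exact hxd t ht

/-! ### Equilibria -/

theorem isEquilibrium_iff {c : ℝ} : P.IsEquilibrium c ↔ 0 ≤ c ∧ P.rhs c c = 0 := by
  refine and_congr_right fun hc => ⟨fun h => ?_, fun h => ⟨continuousOn_const, fun _ => rfl, ?_⟩⟩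
  · exact (uniqueDiffOn_Ici (0 : ℝ) 0 self_mem_Ici).eq_deriv _ (h.hasDeriv 0 le_rfl)
      (hasDerivWithinAt_const _ _ _)
  · intro t _
    rw [h]
    exact hasDerivWithinAt_const _ _ _

theorem isEquilibrium_iff_rpow {c : ℝ} :
    P.IsEquilibrium c ↔ 0 ≤ c ∧ (c = 0 ∨ c ^ P.n = P.ratio - 1) := by
  rw [isEquilibrium_iff]
  refine and_congr_right fun hc => ?_
  rw [rhs_self, mul_eq_zero]
  refine or_congr_right ?_
  have hp := Real.rpow_nonneg hc P.n
  have hδ := P.δ_pos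
  have : (P.k - 1) * P.β c - P.δ = P.δ / (1 + c ^ P.n) * (P.ratio - 1 - c ^ P.n) := by
    unfold β ratio
    field_simp
    ring
  rw [this, mul_eq_zero, or_iff_right (by positivity), sub_eq_zero, eq_comm]

theorem equilibria_of_le (h : P.ratio ≤ 1) : {c : ℝ | P.IsEquilibrium c} = {0} := by
  ext c
  rw [mem_ofPred_eq, isEquilibrium_iff_rpow, mem_singleton_iff]
  refine ⟨?_, fun h => ⟨h.ge, Or.inl h⟩⟩
  rintro ⟨hc, h0 | h1⟩
  · exact h0
  · by_contra h0
    have := Real.rpow_pos_of_pos (lt_of_le_of_ne hc (Ne.symm h0)) P.n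
    linarith

theorem equilibria_of_gt (h : 1 < P.ratio) :
    {c : ℝ | P.IsEquilibrium c} = {0, (P.ratio - 1) ^ (1 / P.n)} := by
  ext c
  rw [mem_ofPred_eq, isEquilibrium_iff_rpow, mem_insert_iff, mem_singleton_iff]
  have hn := P.n_pos.ne'
  constructor
  · rintro ⟨hc, h0 | h1⟩
    · exact Or.inl h0
    · right
      rw [← h1, one_div, Real.rpow_rpow_inv hc hn]
  · rintro (rfl | rfl)
    · exact ⟨le_rfl, Or.inl rfl⟩
    · refine ⟨Real.rpow_nonneg (by linarith) _, Or.inr ?_⟩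
      rw [one_div, Real.rpow_inv_rpow (by linarith) hn]

theorem equilibria_eq_singleton_iff : {c : ℝ | P.IsEquilibrium c} = {0} ↔ P.ratio ≤ 1 := by
  refine ⟨fun h => ?_, P.equilibria_of_le⟩
  by_contra! hlt
  have hpos : 0 < (P.ratio - 1) ^ (1 / P.n) := Real.rpow_pos_of_pos (by linarith) _
  have : (P.ratio - 1) ^ (1 / P.n) ∈ ({0} : Set ℝ) := by
    rw [← h, P.equilibria_of_gt hlt]
    exact Or.inr rfl
  exact hpos.ne' this

end Leukemia.Params

namespace Leukemia.Params
open Set Filter Topology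

variable (P : Params)

/-! ### The characteristic equation -/

theorem isEigenvalueAt_zero_iff (z : ℂ) : P.IsEigenvalueAt 0 z ↔
    z + (P.δ : ℂ) + (P.β₀ : ℂ) = (P.k : ℂ) * (P.β₀ : ℂ) * Complex.exp (-(z * (P.r : ℂ))) := by
  have hle : -P.r ≤ 0 := neg_nonpos.2 P.r_pos.le
  have hexp : ∀ s : ℝ, HasDerivAt (fun s : ℝ => Complex.exp (z * s)) (z * Complex.exp (z * s)) s := by
    intro s
    have := ((Complex.ofRealCLM.hasDerivAt (x := s)).const_mul z).cexp
    refine this.congr_deriv ?_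
    simp [mul_comm]
  constructor
  · rintro ⟨φ, hφ0, hd, hb⟩
    -- `φ(s) e^{-z s}` is constant
    have hconst : ∀ s : Icc (-P.r) 0, φ s = φ P.right * Complex.exp (z * (s : ℝ)) := by
      have hexp' : ∀ s : ℝ, HasDerivAt (fun s : ℝ => Complex.exp (-(z * s)))
          (-z * Complex.exp (-(z * s))) s := by
        intro s
        have := ((Complex.ofRealCLM.hasDerivAt (x := s)).const_mul z).neg.cexp
        refine this.congr_deriv ?_
        simp [mul_comm]
      have hder : ∀ s ∈ Icc (-P.r) 0, HasDerivWithinAt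
          (fun s : ℝ => IccExtend hle φ s * Complex.exp (-(z * s))) 0 (Icc (-P.r) 0) s := by
        intro s hs
        have := (hd ⟨s, hs⟩).mul (hexp' s).hasDerivWithinAt
        refine this.congr_deriv ?_
        simp only [ContinuousMap.smul_apply, smul_eq_mul, IccExtend_of_mem hle φ hs]
        ring
      intro s
      have h0 : (0 : ℝ) ∈ Icc (-P.r) 0 := ⟨hle, le_rfl⟩
      have := (convex_Icc (-P.r) 0).is_const_of_fderivWithin_eq_zero (𝕜 := ℝ)
        (fun s hs => (hder s hs).differentiableWithinAt) (fun s hs => by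
          have := (hder s hs).hasFDerivWithinAt.fderivWithin
            (uniqueDiffOn_Icc (by linarith [P.r_pos]) s hs)
          rw [this]; ext; simp) s.2 h0
      simp only [IccExtend_val, IccExtend_of_mem hle φ h0, Complex.ofReal_zero, mul_zero, neg_zero,
        Complex.exp_zero, mul_one] at this
      change _ = φ P.right at this
      rw [← this, mul_assoc, ← Complex.exp_add]
      simp
    have hr0 : φ P.right ≠ 0 := by
      intro h
      apply hφ0
      ext s
      rw [hconst s, h, zero_mul, ContinuousMap.zero_apply]
    rw [linCoeff_zero, hconst P.left] at hb
    have hl : ((P.left : ℝ) : ℂ) = -(P.r : ℂ) := by simp [left]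
    rw [hl] at hb
    apply mul_left_cancel₀ hr0
    simp only [ContinuousMap.smul_apply, smul_eq_mul, Complex.ofReal_add, Complex.ofReal_mul,
      mul_neg] at hb
    linear_combination hb
  · intro h
    refine ⟨⟨fun s => Complex.exp (z * (s : ℝ)), by fun_prop⟩, ?_, ?_, ?_⟩
    · intro h0
      exact Complex.exp_ne_zero _ (DFunLike.congr_fun h0 P.right)
    · intro s
      refine (hexp s).hasDerivWithinAt.congr (fun t ht => ?_) ?_
      · rw [IccExtend_of_mem _ _ ht]; rfl
      · rw [IccExtend_val]; rfl
    · rw [linCoeff_zero]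
      have hl : ((P.left : ℝ) : ℂ) = -(P.r : ℂ) := by simp [left]
      have hr : ((P.right : ℝ) : ℂ) = 0 := by simp [right]
      simp only [ContinuousMap.smul_apply, smul_eq_mul, ContinuousMap.coe_mk, hl, hr, mul_zero,
        Complex.exp_zero, mul_neg, Complex.ofReal_add, Complex.ofReal_mul]
      linear_combination h

/-- The characteristic function on the real line. -/
noncomputable def charFun (a : ℝ) : ℝ := a + P.δ + P.β₀ - P.k * P.β₀ * Real.exp (-(a * P.r))

theorem strictMono_charFun : StrictMono P.charFun := by
  intro a b hab
  have hr := P.r_pos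
  have h1 : Real.exp (-(b * P.r)) ≤ Real.exp (-(a * P.r)) := by gcongr
  have h2 := mul_le_mul_of_nonneg_left h1 (mul_pos P.k_pos P.β₀_pos).le
  unfold charFun
  linarith

theorem charFun_zero : P.charFun 0 = P.δ * (1 - P.ratio) := by
  have := P.δ_pos.ne'
  unfold charFun ratio
  field_simp
  simp
  ring

theorem exists_charFun_eq_zero : ∃ a, P.charFun a = 0 := by
  have hc : Continuous P.charFun := by unfold charFun; fun_prop
  have hkb := mul_pos P.k_pos P.β₀_pos
  have hδ := P.δ_pos
  have hβ := P.β₀_pos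
  have hr := P.r_pos
  have h1 : P.charFun (-(P.δ + P.β₀)) ≤ 0 := by
    have := mul_pos hkb (Real.exp_pos (-(-(P.δ + P.β₀) * P.r)))
    unfold charFun
    linarith
  have h2 : 0 ≤ P.charFun (P.k * P.β₀) := by
    have h3 : Real.exp (-(P.k * P.β₀ * P.r)) ≤ 1 :=
      Real.exp_le_one_iff.2 (neg_nonpos.2 (mul_pos hkb hr).le)
    have h4 := mul_le_mul_of_nonneg_left h3 hkb.le
    unfold charFun
    linarith
  obtain ⟨a, -, ha⟩ := intermediate_value_Icc (by linarith) hc.continuousOn ⟨h1, h2⟩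
  exact ⟨a, ha⟩

/-- The leading eigenvalue: the real zero of the characteristic function. -/
noncomputable def leading : ℝ := P.exists_charFun_eq_zero.choose

theorem charFun_leading : P.charFun P.leading = 0 := P.exists_charFun_eq_zero.choose_spec

theorem leading_lt_iff {a : ℝ} : P.leading < a ↔ 0 < P.charFun a := by
  rw [← P.charFun_leading, P.strictMono_charFun.lt_iff_lt]

theorem lt_leading_iff {a : ℝ} : a < P.leading ↔ P.charFun a < 0 := by
  rw [← P.charFun_leading, P.strictMono_charFun.lt_iff_lt]

theorem leading_neg_iff : P.leading < 0 ↔ P.ratio < 1 := by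
  rw [leading_lt_iff, charFun_zero, mul_pos_iff_of_pos_left P.δ_pos, sub_pos]

theorem leading_pos_iff : 0 < P.leading ↔ 1 < P.ratio := by
  rw [lt_leading_iff, charFun_zero, ← mul_zero P.δ, mul_lt_mul_iff_right₀ P.δ_pos, sub_neg]

theorem leading_eq_zero_iff : P.leading = 0 ↔ P.ratio = 1 := by
  rw [← not_iff_not, ← ne_eq, ← ne_eq, ne_iff_lt_or_gt, ne_iff_lt_or_gt, leading_neg_iff]
  exact or_congr_right P.leading_pos_iff

theorem continuous_param : Continuous fun P : Params => (P.β₀, P.n, P.δ, P.γ, P.r) :=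
  continuous_induced_dom

theorem continuous_charFun (a : ℝ) : Continuous fun P : Params => P.charFun a := by
  have h := continuous_param
  have h1 : Continuous fun P : Params => P.β₀ := h.fst
  have h3 : Continuous fun P : Params => P.δ := h.snd.snd.fst
  have h4 : Continuous fun P : Params => P.γ := h.snd.snd.snd.fst
  have h5 : Continuous fun P : Params => P.r := h.snd.snd.snd.snd
  unfold charFun k
  fun_prop

/-- Monotonicity of the characteristic function turns the comparison of its zero with a fixed
number into an open condition on the parameters. -/
theorem continuous_leading : Continuous leading := by
  refine OrderTopology.continuous_iff.2 fun a => ⟨?_, ?_⟩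
  · have : leading ⁻¹' Ioi a = {P | P.charFun a < 0} := ext fun P => P.lt_leading_iff
    rw [this]
    exact isOpen_lt (continuous_charFun a) continuous_const
  · have : leading ⁻¹' Iio a = {P | 0 < P.charFun a} := ext fun P => P.leading_lt_iff
    rw [this]
    exact isOpen_lt continuous_const (continuous_charFun a)

theorem isEigenvalueAt_leading : P.IsEigenvalueAt 0 (P.leading : ℂ) := by
  rw [isEigenvalueAt_zero_iff]
  have h := P.charFun_leading
  unfold charFun at h
  exact_mod_cast sub_eq_zero.1 h

/-- Taking absolute values in the characteristic equation shows `charFun z.re ≤ 0`, with equality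
only for real `z`. -/
theorem re_lt_leading {z : ℂ} (hz : P.IsEigenvalueAt 0 z) (hne : z ≠ (P.leading : ℂ)) :
    z.re < P.leading := by
  rw [isEigenvalueAt_zero_iff] at hz
  have hn : ‖z + (P.δ : ℂ) + (P.β₀ : ℂ)‖ = P.k * P.β₀ * Real.exp (-(z.re * P.r)) := by
    rw [hz, norm_mul, norm_mul, Complex.norm_exp, Complex.norm_of_nonneg P.k_pos.le,
      Complex.norm_of_nonneg P.β₀_pos.le]
    simp
  by_cases him : z.im = 0
  · have hzre : z = (z.re : ℂ) := Complex.ext rfl (by simp [him])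
    rw [hzre] at hz
    have h0 : P.charFun z.re = P.charFun P.leading := by
      rw [charFun_leading]
      exact sub_eq_zero.2 (by exact_mod_cast hz)
    exact absurd (by rw [hzre, P.strictMono_charFun.injective h0]) hne
  · rw [lt_leading_iff]
    have h : |(z + (P.δ : ℂ) + (P.β₀ : ℂ)).re| < _ := Complex.abs_re_lt_norm.2 (by simpa using him)
    rw [hn] at h
    have h' := (le_abs_self _).trans_lt h
    simp only [Complex.add_re, Complex.ofReal_re] at h'
    unfold charFun
    linarith

end Leukemia.Params

namespace Leukemia.Params
open Set Filter Topology MeasureTheory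

variable (P : Params)

/-! ### The Lyapunov functional -/

/-- The functional `V(t) = x(t) + k ∫_{t-r}^t β(x) x` along a solution `x`. -/
noncomputable def lyapunov (x : ℝ → ℝ) (t : ℝ) : ℝ :=
  x t + P.k * ∫ s in (t - P.r)..t, P.flux (x s)

/-- The derivative `((k - 1) β(u) - δ) u` of the Lyapunov functional along a solution with current
value `u`; the delayed value cancels. -/
noncomputable def growth (u : ℝ) : ℝ := (P.k - 1) * P.flux u - P.δ * u

theorem continuous_growth : Continuous P.growth := by
  have := P.continuous_flux
  unfold growth; fun_prop

theorem growth_of_nonneg {u : ℝ} (hu : 0 ≤ u) : P.growth u = u * ((P.k - 1) * P.β u - P.δ) := by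
  rw [growth, P.flux_of_nonneg hu]; ring

variable {P} {φ : C(Icc (-P.r) 0, ℝ)} {x : ℝ → ℝ}

/-- The values of a solution to the left of `-r` being irrelevant, they may be chosen so that the
solution is continuous on the whole line. -/
theorem IsSolution.exists_continuous (h : P.IsSolution φ x) :
    ∃ y, Continuous y ∧ EqOn y x (Ici (-P.r)) ∧ P.IsSolution φ y := by
  have he : EqOn (fun t => x (max t (-P.r))) x (Ici (-P.r)) := fun t ht => by
    simp only [max_eq_left (mem_Ici.1 ht)]
  exact ⟨_, h.continuousOn.comp_continuous (by fun_prop) fun t => mem_Ici.2 (le_max_right _ _), he, h.congr he⟩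

theorem IsSolution.hasDerivAt (h : P.IsSolution φ x) {t : ℝ} (ht : 0 < t) :
    HasDerivAt x (P.rhs (x t) (x (t - P.r))) t :=
  (h.hasDeriv t ht.le).hasDerivAt (Ici_mem_nhds ht)

theorem hasDerivAt_primitive_flux (hc : Continuous x) (t : ℝ) :
    HasDerivAt (fun t => ∫ s in (0 : ℝ)..t, P.flux (x s)) (P.flux (x t)) t := by
  have hf : Continuous fun s => P.flux (x s) := P.continuous_flux.comp hc
  exact intervalIntegral.integral_hasDerivAt_right (hf.intervalIntegrable _ _)
    (hf.stronglyMeasurableAtFilter _ _) hf.continuousAt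

theorem lyapunov_eq (hc : Continuous x) (t : ℝ) : P.lyapunov x t = x t + P.k *
    ((∫ s in (0 : ℝ)..t, P.flux (x s)) - ∫ s in (0 : ℝ)..(t - P.r), P.flux (x s)) := by
  have hf : Continuous fun s => P.flux (x s) := P.continuous_flux.comp hc
  rw [lyapunov, intervalIntegral.integral_interval_sub_left (hf.intervalIntegrable _ _)
    (hf.intervalIntegrable _ _)]

theorem continuous_lyapunov (hc : Continuous x) : Continuous (P.lyapunov x) := by
  have h1 : Continuous fun t => ∫ s in (0 : ℝ)..t, P.flux (x s) :=
    continuous_iff_continuousAt.2 fun t => (hasDerivAt_primitive_flux hc t).continuousAt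
  rw [funext (lyapunov_eq hc)]
  exact hc.add (continuous_const.mul (h1.sub (h1.comp (continuous_id.sub continuous_const))))

theorem IsSolution.hasDerivAt_lyapunov (h : P.IsSolution φ x) (hc : Continuous x)
    (hn : ∀ t, -P.r ≤ t → 0 ≤ x t) {t : ℝ} (ht : 0 < t) :
    HasDerivAt (P.lyapunov x) (P.growth (x t)) t := by
  rw [funext (lyapunov_eq hc)]
  have hr := P.r_pos
  have h1 := hasDerivAt_primitive_flux (P := P) hc
  have h2 := (h1 (t - P.r)).comp t ((hasDerivAt_id t).sub_const P.r)
  refine ((h.hasDerivAt ht).add (((h1 t).sub h2).const_mul P.k)).congr_deriv ?_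
  rw [P.rhs_of_nonneg (hn t (by linarith)) (hn _ (by linarith)), growth]
  ring

theorem IsSolution.integral_growth (h : P.IsSolution φ x) (hc : Continuous x)
    (hn : ∀ t, -P.r ≤ t → 0 ≤ x t) {a b : ℝ} (ha : 0 ≤ a) (hab : a ≤ b) :
    ∫ s in a..b, P.growth (x s) = P.lyapunov x b - P.lyapunov x a :=
  intervalIntegral.integral_eq_sub_of_hasDerivAt_of_le hab (continuous_lyapunov hc).continuousOn
    (fun _ hs => h.hasDerivAt_lyapunov hc hn (ha.trans_lt hs.1))
    ((P.continuous_growth.comp hc).intervalIntegrable _ _)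

theorem le_lyapunov (t : ℝ) : x t ≤ P.lyapunov x t := by
  have h := intervalIntegral.integral_nonneg (μ := volume) (by linarith [P.r_pos] : t - P.r ≤ t)
    (fun s _ => P.flux_nonneg (x s))
  have := mul_nonneg P.k_pos.le h
  unfold lyapunov
  linarith

theorem lyapunov_le (hc : Continuous x) (hn : ∀ t, -P.r ≤ t → 0 ≤ x t) {t M : ℝ} (ht : 0 ≤ t)
    (hM : ∀ s ∈ Icc (t - P.r) t, x s ≤ M) :
    P.lyapunov x t ≤ M * (1 + P.k * P.β₀ * P.r) := by
  have hr := P.r_pos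
  have h : ∫ s in (t - P.r)..t, P.flux (x s) ≤ ∫ _ in (t - P.r)..t, P.β₀ * M :=
    intervalIntegral.integral_mono_on (by linarith)
      ((P.continuous_flux.comp hc).intervalIntegrable _ _) intervalIntegrable_const
      fun s hs => (P.flux_le (hn s (by linarith [hs.1]))).trans
        (mul_le_mul_of_nonneg_left (hM s hs) P.β₀_pos.le)
  rw [intervalIntegral.integral_const, smul_eq_mul] at h
  have h1 := mul_le_mul_of_nonneg_left h P.k_pos.le
  have h2 := hM t ⟨by linarith, le_rfl⟩
  unfold lyapunov
  linarith

/-- A nonnegative solution decays at most exponentially, because `x' ≥ -(β₀ + δ) x`. -/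
theorem IsSolution.exp_mul_le (h : P.IsSolution φ x) (hc : Continuous x)
    (hn : ∀ t, -P.r ≤ t → 0 ≤ x t) {t s : ℝ} (ht : 0 ≤ t) (hts : t ≤ s) :
    Real.exp (-((P.β₀ + P.δ) * (s - t))) * x t ≤ x s := by
  have hr := P.r_pos
  have hm : MonotoneOn (fun t => Real.exp ((P.β₀ + P.δ) * t) * x t) (Ici 0) := by
    refine monotoneOn_of_hasDerivWithinAt_nonneg (convex_Ici 0) (by fun_prop)
      (f' := fun t => Real.exp ((P.β₀ + P.δ) * t) * (P.β₀ + P.δ) * x t +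
        Real.exp ((P.β₀ + P.δ) * t) * P.rhs (x t) (x (t - P.r))) (fun t ht => ?_) (fun t ht => ?_)
    · rw [interior_Ici] at ht
      have := (((hasDerivAt_id t).const_mul (P.β₀ + P.δ)).exp.mul (h.hasDerivAt ht))
      exact (this.congr_deriv (by simp)).hasDerivWithinAt
    · rw [interior_Ici] at ht
      have ht : 0 < t := ht
      have h1 := hn t (by linarith)
      have h2 := hn (t - P.r) (by linarith)
      rw [mul_assoc, ← mul_add, P.rhs_of_nonneg h1 h2]
      refine mul_nonneg (Real.exp_pos _).le ?_
      have h3 := P.flux_le h1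
      have h4 := mul_nonneg P.k_pos.le (P.flux_nonneg (x (t - P.r)))
      linarith
  have h1 := hm (mem_Ici.2 ht) (mem_Ici.2 (ht.trans hts)) hts
  have h2 := mul_le_mul_of_nonneg_left h1 (Real.exp_pos (-((P.β₀ + P.δ) * s))).le
  simp only [← mul_assoc, ← Real.exp_add] at h2
  rw [neg_add_cancel, Real.exp_zero, one_mul] at h2
  have h3 : -((P.β₀ + P.δ) * (s - t)) = -((P.β₀ + P.δ) * s) + (P.β₀ + P.δ) * t := by ring
  rwa [h3]

/-- If the Lyapunov functional converges and its derivative, up to the sign `σ`, is bounded below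
by a positive constant while `x ≥ ε`, then `x → 0`: as `x` decays at most exponentially, `x t ≥ ε`
would force a definite change of the functional on `[t, t + 1]`. -/
theorem IsSolution.tendsto_zero (h : P.IsSolution φ x) (hc : Continuous x)
    (hn : ∀ t, -P.r ≤ t → 0 ≤ x t) {σ ℓ : ℝ}
    (hσ : ∀ ε > 0, ∃ c > 0, ∀ t, 0 ≤ t → ε ≤ x t → c ≤ σ * P.growth (x t))
    (hV : Tendsto (P.lyapunov x) atTop (𝓝 ℓ)) : Tendsto x atTop (𝓝 0) := by
  have hr := P.r_pos
  have hK : 0 < P.β₀ + P.δ := add_pos P.β₀_pos P.δ_pos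
  have hdiff : Tendsto (fun t => σ * (P.lyapunov x (t + 1) - P.lyapunov x t)) atTop (𝓝 0) := by
    have := ((hV.comp (tendsto_atTop_add_const_right _ (1 : ℝ) tendsto_id)).sub hV).const_mul σ
    simpa using this
  rw [Metric.tendsto_atTop']
  intro ε hε
  obtain ⟨c, hc0, hcb⟩ := hσ (Real.exp (-(P.β₀ + P.δ)) * ε) (by positivity)
  obtain ⟨T, hT⟩ := eventually_atTop.1 (hdiff.eventually (gt_mem_nhds hc0))
  refine ⟨max T 0, fun t ht => ?_⟩
  have ht0 : 0 ≤ t := (le_max_right T 0).trans ht.le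
  rw [Real.dist_eq, sub_zero, abs_of_nonneg (hn t (by linarith))]
  by_contra! hx
  have hge : c ≤ σ * (P.lyapunov x (t + 1) - P.lyapunov x t) := by
    rw [← h.integral_growth hc hn ht0 (by linarith), ← intervalIntegral.integral_const_mul]
    have h1 : ∫ _ in t..(t + 1), c = c := by simp
    refine h1.symm.trans_le (intervalIntegral.integral_mono_on (by linarith)
      intervalIntegrable_const
      ((continuous_const.mul (P.continuous_growth.comp hc)).intervalIntegrable _ _) fun s hs => ?_)
    refine hcb s (ht0.trans hs.1) (le_trans ?_ (h.exp_mul_le hc hn ht0 hs.1))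
    have h2 : (P.β₀ + P.δ) * (s - t) ≤ P.β₀ + P.δ := by
      have := hs.2
      exact mul_le_of_le_one_right hK.le (by linarith)
    gcongr
  linarith [hT t ((le_max_left T 0).trans ht.le)]

/-! ### Stability -/

theorem IsSolution.bound (h : P.IsSolution φ x) {t : ℝ} (h1 : -P.r ≤ t) (h2 : t ≤ 0) :
    x t ≤ ‖φ‖ := by
  have h3 : x t = φ ⟨t, h1, h2⟩ := h.initial ⟨t, h1, h2⟩
  rw [h3]
  exact (le_abs_self _).trans (φ.norm_coe_le_norm _)

variable (P) in
theorem growth_nonpos (hR : P.ratio ≤ 1) {u : ℝ} (hu : 0 ≤ u) : P.growth u ≤ 0 := by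
  rw [P.growth_of_nonneg hu]
  refine mul_nonpos_of_nonneg_of_nonpos hu ?_
  rw [ratio, div_le_one P.δ_pos] at hR
  have h1 := P.β_le hu
  have h2 := P.β_pos hu
  have hδ := P.δ_pos
  rcases le_total P.k 1 with hk | hk
  · nlinarith
  · nlinarith

variable (P) in
theorem exists_growth_le (hR : P.ratio ≤ 1) {ε : ℝ} (hε : 0 < ε) :
    ∃ c > 0, ∀ u, ε ≤ u → c ≤ -1 * P.growth u := by
  rw [ratio, div_le_one P.δ_pos] at hR
  have hδ := P.δ_pos
  rcases le_total P.k 1 with hk | hk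
  · refine ⟨ε * P.δ, by positivity, fun u hu => ?_⟩
    rw [P.growth_of_nonneg (hε.le.trans hu)]
    have h2 := P.β_pos (hε.le.trans hu)
    have h3 : P.δ ≤ P.δ - (P.k - 1) * P.β u := by nlinarith
    have := mul_le_mul hu h3 hδ.le (hε.le.trans hu)
    linarith
  · have hlt : 0 < P.δ - (P.k - 1) * P.β ε := by
      rcases hk.eq_or_lt with hk | hk
      · rw [← hk]; linarith
      · have := mul_lt_mul_of_pos_left (P.β_lt hε) (sub_pos.2 hk)
        linarith
    refine ⟨ε * (P.δ - (P.k - 1) * P.β ε), by positivity, fun u hu => ?_⟩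
    rw [P.growth_of_nonneg (hε.le.trans hu)]
    have h1 := mul_le_mul_of_nonneg_left (P.β_anti hε.le hu) (sub_nonneg.2 hk)
    have := mul_le_mul hu (by linarith : P.δ - (P.k - 1) * P.β ε ≤ P.δ - (P.k - 1) * P.β u) hlt.le
      (hε.le.trans hu)
    linarith

theorem IsSolution.lyapunov_anti (h : P.IsSolution φ x) (hc : Continuous x)
    (hn : ∀ t, -P.r ≤ t → 0 ≤ x t) (hR : P.ratio ≤ 1) {a b : ℝ} (ha : 0 ≤ a) (hab : a ≤ b) :
    P.lyapunov x b ≤ P.lyapunov x a := by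
  have hr := P.r_pos
  have h1 := h.integral_growth hc hn ha hab
  have h2 : 0 ≤ ∫ s in a..b, -P.growth (x s) := intervalIntegral.integral_nonneg hab fun s hs =>
    neg_nonneg.2 (P.growth_nonpos hR (hn s (by linarith [hs.1])))
  rw [intervalIntegral.integral_neg] at h2
  linarith

theorem zeroStable_of_ratio_le (hR : P.ratio ≤ 1) : P.ZeroStable := by
  have hr := P.r_pos
  have hk := P.k_pos
  have hβ := P.β₀_pos
  intro ε hε
  refine ⟨ε / (1 + P.k * P.β₀ * P.r), by positivity, fun φ x hφ hη h t ht => ?_⟩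
  obtain ⟨y, hyc, hyx, hy⟩ := h.exists_continuous
  have hn := hy.nonneg hφ
  rw [← hyx (mem_Ici.2 (by linarith) : t ∈ Ici (-P.r))]
  refine ⟨hn t (by linarith), ?_⟩
  calc y t ≤ P.lyapunov y t := le_lyapunov t
    _ ≤ P.lyapunov y 0 := hy.lyapunov_anti hyc hn hR le_rfl ht.le
    _ ≤ ‖φ‖ * (1 + P.k * P.β₀ * P.r) :=
      lyapunov_le hyc hn le_rfl fun s hs => hy.bound (by linarith [hs.1]) hs.2
    _ < ε := (lt_div_iff₀ (by positivity)).1 hη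

/-- For `ratio ≤ 1` the zero solution attracts all nonnegative solutions. -/
theorem IsSolution.tendsto_zero_of_ratio_le (h : P.IsSolution φ x) (hφ : ∀ s, 0 ≤ φ s)
    (hR : P.ratio ≤ 1) : Tendsto x atTop (𝓝 0) := by
  have hr := P.r_pos
  obtain ⟨y, hyc, hyx, hy⟩ := h.exists_continuous
  have hn := hy.nonneg hφ
  have hev : y =ᶠ[atTop] x := (eventually_ge_atTop (-P.r)).mono fun t ht => hyx ht
  refine Tendsto.congr' hev ?_
  have hanti : Antitone fun t => P.lyapunov y (max t 0) := fun a b hab =>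
    hy.lyapunov_anti hyc hn hR (le_max_right _ _) (max_le_max_right 0 hab)
  have hlim := tendsto_atTop_ciInf hanti ⟨0, by
    rintro _ ⟨t, rfl⟩
    exact (hn _ (by linarith [le_max_right t 0])).trans (le_lyapunov _)⟩
  refine hy.tendsto_zero hyc hn (σ := -1) (fun ε hε => ?_) (hlim.congr' ?_)
  · obtain ⟨c, hc, hcb⟩ := P.exists_growth_le hR hε
    exact ⟨c, hc, fun t _ => hcb _⟩
  · filter_upwards [eventually_ge_atTop 0] with t ht
    rw [max_eq_left ht]

/-- A small positive solution that stayed small would have an increasing, bounded Lyapunov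
functional. Hence it would tend to `0`, and so would the functional, which starts at a positive
value. -/
theorem not_zeroStable (hR : 1 < P.ratio) : ¬ P.ZeroStable := by
  intro hS
  have hr := P.r_pos
  have hk1 : 0 < P.k - 1 := by
    rw [ratio, one_lt_div P.δ_pos] at hR
    exact pos_of_mul_pos_right (P.δ_pos.trans hR) P.β₀_pos.le
  -- below the level `ε` the functional grows at the rate at least `w x`
  obtain ⟨ε, hε, hw⟩ : ∃ ε > 0, 0 < (P.k - 1) * P.β ε - P.δ := by
    have h1 : Tendsto (fun u => (P.k - 1) * P.β u - P.δ) (𝓝 0) (𝓝 ((P.k - 1) * P.β 0 - P.δ)) :=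
      (P.continuousAt_β_zero.tendsto.const_mul _).sub_const _
    have h2 : 0 < (P.k - 1) * P.β 0 - P.δ := by
      rw [ratio, one_lt_div P.δ_pos] at hR
      rw [β_zero]
      linarith
    obtain ⟨d, hd, hb⟩ := Metric.eventually_nhds_iff.1 (h1.eventually (lt_mem_nhds h2))
    exact ⟨d / 2, by positivity, hb (by rw [Real.dist_eq, sub_zero, abs_of_pos] <;> linarith)⟩
  set w := (P.k - 1) * P.β ε - P.δ with hwdef
  have hgrow : ∀ u, 0 ≤ u → u ≤ ε → w * u ≤ P.growth u := by
    intro u h0 h1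
    rw [P.growth_of_nonneg h0, mul_comm]
    refine mul_le_mul_of_nonneg_left ?_ h0
    have := mul_le_mul_of_nonneg_left (P.β_anti h0 h1) hk1.le
    linarith
  obtain ⟨η, hη, hst⟩ := hS ε hε
  have hm : 0 < min η ε / 2 := half_pos (lt_min hη hε)
  set φ : C(Icc (-P.r) 0, ℝ) := ContinuousMap.const _ (min η ε / 2)
  have hφ : ∀ s, 0 ≤ φ s := fun _ => hm.le
  have hnorm : ‖φ‖ ≤ min η ε / 2 := (ContinuousMap.norm_le _ hm.le).2 fun s => by
    change |min η ε / 2| ≤ _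
    rw [abs_of_pos hm]
  obtain ⟨x₀, hx₀⟩ := P.exists_isSolution φ hφ
  obtain ⟨x, hc, -, hx⟩ := hx₀.exists_continuous
  have hn := hx.nonneg hφ
  have hsmall : ∀ t, -P.r ≤ t → x t ≤ ε := by
    intro t ht
    rcases le_or_gt t 0 with h | h
    · linarith [hx.bound ht h, min_le_right η ε]
    · exact (hst φ x hφ (by linarith [min_le_left η ε]) hx t h).2.le
  have hmono : ∀ a b, 0 ≤ a → a ≤ b → P.lyapunov x a ≤ P.lyapunov x b := by
    intro a b ha hab
    rw [← sub_nonneg, ← hx.integral_growth hc hn ha hab]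
    refine intervalIntegral.integral_nonneg hab fun s hs => ?_
    have h1 := hn s (by linarith [hs.1])
    exact (mul_nonneg hw.le h1).trans (hgrow _ h1 (hsmall s (by linarith [hs.1])))
  have hMono : Monotone fun t => P.lyapunov x (max t 0) := fun a b hab =>
    hmono _ _ (le_max_right _ _) (max_le_max_right 0 hab)
  have hlim := tendsto_atTop_ciSup hMono ⟨ε * (1 + P.k * P.β₀ * P.r), by
    rintro _ ⟨t, rfl⟩
    have ht := le_max_right t 0
    exact lyapunov_le hc hn ht fun s hs => hsmall s (by linarith [hs.1])⟩
  have hlim' : Tendsto (P.lyapunov x) atTop (𝓝 (⨆ t, P.lyapunov x (max t 0))) := by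
    refine hlim.congr' ?_
    filter_upwards [eventually_ge_atTop 0] with t ht
    rw [max_eq_left ht]
  have hx0 : Tendsto x atTop (𝓝 0) := by
    refine hx.tendsto_zero hc hn (σ := 1) (fun e he => ⟨w * e, by positivity, fun t ht het => ?_⟩)
      hlim'
    rw [one_mul]
    exact (mul_le_mul_of_nonneg_left het hw.le).trans
      (hgrow _ (hn t (by linarith)) (hsmall t (by linarith)))
  have hpos : 0 < P.lyapunov x 0 := by
    refine lt_of_lt_of_le ?_ (le_lyapunov 0)
    have h0 : x 0 = min η ε / 2 := hx.initial P.right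
    rw [h0]
    exact hm
  have hD : 0 < 1 + P.k * P.β₀ * P.r := by
    have := mul_pos (mul_pos P.k_pos P.β₀_pos) hr
    linarith
  obtain ⟨T, hT⟩ := eventually_atTop.1 (hx0.eventually
    (gt_mem_nhds (show 0 < P.lyapunov x 0 / 2 / (1 + P.k * P.β₀ * P.r) by positivity)))
  have hT0 : 0 ≤ max T 0 + P.r := by linarith [le_max_right T 0]
  have h1 := lyapunov_le hc hn hT0 fun s hs => (hT s (by linarith [hs.1, le_max_left T 0])).le
  rw [div_mul_cancel₀ _ hD.ne'] at h1
  linarith [hmono 0 _ le_rfl hT0]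

theorem zeroLocallyAsymptoticallyStable_iff :
    P.ZeroLocallyAsymptoticallyStable ↔ P.ratio ≤ 1 := by
  constructor
  · intro h
    by_contra! hR
    exact not_zeroStable hR h.1
  · exact fun hR => ⟨zeroStable_of_ratio_le hR, 1, one_pos,
      fun φ x hφ _ hx => hx.tendsto_zero_of_ratio_le hφ hR⟩

end Leukemia.Params

/-! ### The change of stability at `ratio = 1` -/

theorem mainTheorem3 :
    -- for all parameters
    (∀ P : Leukemia.Params,
      -- the Cauchy problem with nonnegative initial function is well posed
      (∀ φ : C(Set.Icc (-P.r) 0, ℝ), (∀ s, 0 ≤ φ s) →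
        ∃ x : ℝ → ℝ, P.IsSolution φ x ∧ (∀ t : ℝ, 0 ≤ t → 0 ≤ x t) ∧
          ∀ y : ℝ → ℝ, P.IsSolution φ y → Set.EqOn y x (Set.Ici (-P.r))) ∧
      -- equilibria
      (P.ratio ≤ 1 → {c : ℝ | P.IsEquilibrium c} = {0}) ∧
      (1 < P.ratio → 0 < (P.ratio - 1) ^ (1 / P.n) ∧
        {c : ℝ | P.IsEquilibrium c} = {0, (P.ratio - 1) ^ (1 / P.n)}) ∧
      -- eigenvalues of the linearization at zero
      (∀ z : ℂ, P.IsEigenvalueAt 0 z ↔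
        z + (P.δ : ℂ) + (P.β₀ : ℂ) = (P.k : ℂ) * (P.β₀ : ℂ) * Complex.exp (-(z * (P.r : ℂ)))) ∧
      ((∀ z : ℂ, P.IsEigenvalueAt 0 z → z.re < 0) ↔ P.ratio < 1) ∧
      -- stability and instability of the zero equilibrium
      (P.ZeroLocallyAsymptoticallyStable ↔ P.ratio ≤ 1) ∧
      (P.ZeroLocallyAsymptoticallyStable ↔ {c : ℝ | P.IsEquilibrium c} = {0}) ∧
      (1 < P.ratio → ¬ P.ZeroStable)) ∧
    -- the change of stability: the leading eigenvalue is real, depends continuously on the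
    -- parameters and crosses the imaginary axis at `0` exactly when the ratio crosses `1`
    (∃ μ : Leukemia.Params → ℝ, Continuous μ ∧ ∀ P : Leukemia.Params,
      P.IsEigenvalueAt 0 (μ P : ℂ) ∧
      (∀ z : ℂ, P.IsEigenvalueAt 0 z → z ≠ (μ P : ℂ) → z.re < μ P) ∧
      (μ P < 0 ↔ P.ratio < 1) ∧ (μ P = 0 ↔ P.ratio = 1) ∧ (0 < μ P ↔ 1 < P.ratio)) := by
  refine ⟨fun P => ⟨fun φ hφ => ?_, P.equilibria_of_le, fun hR => ⟨?_, P.equilibria_of_gt hR⟩,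
    P.isEigenvalueAt_zero_iff, ⟨fun h => ?_, fun hR z hz => ?_⟩,
    Leukemia.Params.zeroLocallyAsymptoticallyStable_iff,
    Leukemia.Params.zeroLocallyAsymptoticallyStable_iff.trans P.equilibria_eq_singleton_iff.symm,
    Leukemia.Params.not_zeroStable⟩,
    Leukemia.Params.leading, Leukemia.Params.continuous_leading, fun P =>
      ⟨P.isEigenvalueAt_leading, fun z => P.re_lt_leading, P.leading_neg_iff,
        P.leading_eq_zero_iff, P.leading_pos_iff⟩⟩
  · obtain ⟨x, hx⟩ := P.exists_isSolution φ hφ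
    exact ⟨x, hx, fun t ht => hx.nonneg hφ t (by linarith [P.r_pos]), fun y hy => hx.eqOn hy hφ⟩
  · exact Real.rpow_pos_of_pos (sub_pos.2 hR) _
  · exact P.leading_neg_iff.1 (h _ P.isEigenvalueAt_leading)
  · have hneg := P.leading_neg_iff.2 hR
    by_cases he : z = (P.leading : ℂ)
    · rw [he, Complex.ofReal_re]
      exact hneg
    · exact (P.re_lt_leading hz he).trans hneg
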